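/- Let $\varphi=(1+\sqrt5)/2$ be the golden mean. Every natural number $N\ge 0$ can be written in exactly one way as a finite sum $N=\sum_{i\in\mathbb Z} d_i\varphi^i$ with digits $d_i=d_i(N)\in\{0,1\}$, only finitely many of which are nonzero, such that no two consecutive digits $d_i,d_{i+1}$ are both equal to $1$ (the base phi expansion of $N$). Let $s_\beta(N)=\sum_{i} d_i(N)$ be its sum of digits, and let $\mathrm T=(\mathrm T(N))_{N\ge 0}$ be the infinite word over $\{0,1\}$ given by $\mathrm T(N)=s_\beta(N) \bmod 2$. Then the letters $0$ and $1$ both have frequency $\tfrac12$ in $\mathrm T$; that is, for each $a\in\{0,1\}$, $$\lim_{n\to\infty}\frac{\#\{0\le N<n : \mathrm T(N)=a\}}{n}=\frac12 .$$ -/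

import Mathlib

open Filter Topology

namespace BasePhi

/-- A finite digit expansion `(d i)`, `i : ℤ`, with digits `0` and `1` is given by the finite set
`S` of the positions `i` with `d i = 1`. The set is admissible if no two consecutive digits are
both `1`. -/
def Admissible (S : Finset ℤ) : Prop := ∀ i ∈ S, i + 1 ∉ S

/-- The real number `∑ i, d i * φ ^ i`, where `φ` is the golden mean `(1 + √5) / 2`. -/
noncomputable def value (S : Finset ℤ) : ℝ := ∑ i ∈ S, Real.goldenRatio ^ i

/-- `S` is (the set of positions of the digit `1` of) a base phi expansion of `N`. -/
def IsExpansion (N : ℕ) (S : Finset ℤ) : Prop := Admissible S ∧ value S = (N : ℝ)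

theorem zpow_add_zpow (k : ℤ) :
    Real.goldenRatio ^ k + Real.goldenRatio ^ (k + 1) = Real.goldenRatio ^ (k + 2) := by
  have h0 := Real.goldenRatio_ne_zero
  rw [zpow_add₀ h0, zpow_add₀ h0]
  have h2 : Real.goldenRatio ^ (2 : ℤ) = Real.goldenRatio + 1 := by
    exact_mod_cast Real.goldenRatio_sq
  rw [h2, zpow_one]
  ring

theorem two_mul_zpow (k : ℤ) :
    2 * Real.goldenRatio ^ k = Real.goldenRatio ^ (k + 1) + Real.goldenRatio ^ (k - 2) := by
  have h1 := zpow_add_zpow (k - 2)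
  have h2 := zpow_add_zpow (k - 1)
  rw [show k - 2 + 1 = k - 1 by ring, show k - 2 + 2 = k by ring] at h1
  rw [show k - 1 + 1 = k by ring, show k - 1 + 2 = k + 1 by ring] at h2
  linarith

theorem value_erase {S : Finset ℤ} {k : ℤ} (h : k ∈ S) :
    value (S.erase k) + Real.goldenRatio ^ k = value S :=
  Finset.sum_erase_add S _ h

theorem value_insert {S : Finset ℤ} {k : ℤ} (h : k ∉ S) :
    value (insert k S) = Real.goldenRatio ^ k + value S :=
  Finset.sum_insert h

theorem Admissible.erase {S : Finset ℤ} (h : Admissible S) (k : ℤ) : Admissible (S.erase k) :=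
  fun i hi hi' => h i (Finset.mem_of_mem_erase hi) (Finset.mem_of_mem_erase hi')

theorem Admissible.insert {S : Finset ℤ} (h : Admissible S) {k : ℤ} (h1 : k + 1 ∉ S)
    (h2 : k - 1 ∉ S) : Admissible (insert k S) := by
  intro i hi hi'
  rw [Finset.mem_insert] at hi hi'
  rcases hi with rfl | hi
  · rcases hi' with h' | h'
    · omega
    · exact h1 h'
  · rcases hi' with h' | h'
    · exact h2 (by rwa [show k - 1 = i by omega])
    · exact h i hi h'

/-- A power of `φ` can be added to an admissible expansion. -/
theorem exists_add_zpow (n m : ℕ) (S : Finset ℤ) (k : ℤ) (hn : S.card = n)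
    (hm : (S.filter (· ≤ k)).card = m) (hS : Admissible S) :
    ∃ U : Finset ℤ, Admissible U ∧ value U = value S + Real.goldenRatio ^ k ∧
      U.card ≤ S.card + 1 := by
  induction n using Nat.strong_induction_on generalizing m S k with
  | _ n ihn =>
  induction m using Nat.strong_induction_on generalizing S k with
  | _ m ihm =>
  by_cases hk : k ∈ S
  · have hk1 : k + 1 ∉ S := hS k hk
    have hc := Finset.card_erase_add_one hk
    have hv := value_erase hk
    have h2 := two_mul_zpow k
    by_cases hk2 : k + 2 ∈ S
    · have hk2' : k + 2 ∈ S.erase k := Finset.mem_erase.2 ⟨by omega, hk2⟩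
      have hc' := Finset.card_erase_add_one hk2'
      have hv' := value_erase hk2'
      obtain ⟨U, hU, hUv, hUc⟩ := ihn _ (by omega) _ ((S.erase k).erase (k + 2)) (k + 3) rfl rfl
        ((hS.erase k).erase _)
      obtain ⟨V, hV, hVv, hVc⟩ := ihn _ (by omega) _ U (k - 2) rfl rfl hU
      refine ⟨V, hV, ?_, by omega⟩
      have h3 := zpow_add_zpow (k + 1)
      rw [show k + 1 + 1 = k + 2 by ring, show k + 1 + 2 = k + 3 by ring] at h3
      linarith
    · have hk1' : k + 1 ∉ S.erase k := fun h => hk1 (Finset.mem_of_mem_erase h)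
      have hA : Admissible (Insert.insert (k + 1) (S.erase k)) := by
        refine (hS.erase k).insert ?_ ?_
        · intro h
          exact hk2 (by simpa [show k + 1 + 1 = k + 2 by ring] using Finset.mem_of_mem_erase h)
        · simp
      have hv1 := value_insert hk1'
      have hc1 := Finset.card_insert_of_notMem hk1'
      have hlt : ((Insert.insert (k + 1) (S.erase k)).filter (· ≤ k - 2)).card < m := by
        rw [← hm]
        refine Finset.card_lt_card ?_
        rw [Finset.ssubset_iff_of_subset]
        · exact ⟨k, by simp [hk], by simp⟩
        · intro x hx
          simp only [Finset.mem_filter, Finset.mem_insert, Finset.mem_erase] at hx ⊢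
          obtain ⟨h | h, h'⟩ := hx
          · omega
          · exact ⟨h.2, by omega⟩
      obtain ⟨U, hU, hUv, hUc⟩ := ihm _ hlt _ (k - 2) (by omega) rfl hA
      exact ⟨U, hU, by linarith, by omega⟩
  · by_cases hp : k + 1 ∈ S
    · have hc := Finset.card_erase_add_one hp
      have hv := value_erase hp
      have h2 := zpow_add_zpow k
      obtain ⟨U, hU, hUv, hUc⟩ := ihn _ (by omega) _ (S.erase (k + 1)) (k + 2) rfl rfl
        (hS.erase _)
      exact ⟨U, hU, by linarith, by omega⟩
    · by_cases hq : k - 1 ∈ S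
      · have hc := Finset.card_erase_add_one hq
        have hv := value_erase hq
        have h2 := zpow_add_zpow (k - 1)
        rw [show k - 1 + 1 = k by ring, show k - 1 + 2 = k + 1 by ring] at h2
        obtain ⟨U, hU, hUv, hUc⟩ := ihn _ (by omega) _ (S.erase (k - 1)) (k + 1) rfl rfl
          (hS.erase _)
        exact ⟨U, hU, by linarith, by omega⟩
      · refine ⟨Insert.insert k S, hS.insert hp hq, ?_, ?_⟩
        · rw [value_insert hk, add_comm]
        · rw [Finset.card_insert_of_notMem hk]

theorem exists_isExpansion (N : ℕ) : ∃ S, IsExpansion N S := by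
  induction N with
  | zero => exact ⟨∅, fun i hi => absurd hi (Finset.notMem_empty i), by simp [value]⟩
  | succ N ih =>
    obtain ⟨S, hS, hv⟩ := ih
    obtain ⟨U, hU, hUv, -⟩ := exists_add_zpow _ _ S 0 rfl rfl hS
    exact ⟨U, hU, by rw [hUv, hv]; simp⟩

theorem value_lt (S : Finset ℤ) (hS : Admissible S) (m : ℤ) (hm : ∀ i ∈ S, i < m) :
    value S < Real.goldenRatio ^ m := by
  induction hn : S.card generalizing S m with
  | zero =>
    rw [Finset.card_eq_zero] at hn
    subst hn
    simpa [value] using zpow_pos Real.goldenRatio_pos m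
  | succ n ih =>
    have hne : S.Nonempty := Finset.card_pos.1 (by omega)
    have hM := S.max'_mem hne
    set M := S.max' hne with hMdef
    have hc := Finset.card_erase_add_one hM
    have hlt : value (S.erase M) < Real.goldenRatio ^ (M - 1) := by
      refine ih _ (hS.erase M) _ (fun i hi => ?_) (by omega)
      rw [Finset.mem_erase] at hi
      have h1 := S.le_max' i hi.2
      have h2 : i + 1 ≠ M := fun h => hS i hi.2 (h ▸ hM)
      have h3 := hi.1
      omega
    have hv := value_erase hM
    have h2 := zpow_add_zpow (M - 1)
    rw [show M - 1 + 1 = M by ring, show M - 1 + 2 = M + 1 by ring] at h2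
    have hle : Real.goldenRatio ^ (M + 1) ≤ Real.goldenRatio ^ m :=
      zpow_le_zpow_right₀ Real.one_lt_goldenRatio.le (by have := hm M hM; omega)
    linarith

theorem zpow_le_value {S : Finset ℤ} {k : ℤ} (hk : k ∈ S) : Real.goldenRatio ^ k ≤ value S :=
  Finset.single_le_sum (f := fun i : ℤ => Real.goldenRatio ^ i)
    (fun i _ => (zpow_pos Real.goldenRatio_pos i).le) hk

theorem value_injective (S U : Finset ℤ) (hS : Admissible S) (hU : Admissible U)
    (h : value S = value U) : S = U := by
  have key : ∀ A B : Finset ℤ, Admissible A → value A = value B → ∀ b ∈ B, ∃ a ∈ A, b ≤ a := by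
    intro A B hA hAB b hb
    by_contra! hcon
    have h1 := value_lt A hA b hcon
    have h2 := zpow_le_value hb
    linarith
  induction hn : S.card generalizing S U with
  | zero =>
    rw [Finset.card_eq_zero] at hn
    subst hn
    symm
    rw [Finset.eq_empty_iff_forall_notMem]
    intro b hb
    obtain ⟨a, ha, -⟩ := key ∅ U hS h b hb
    exact absurd ha (Finset.notMem_empty a)
  | succ n ih =>
    have hne : S.Nonempty := Finset.card_pos.1 (by omega)
    have hM := S.max'_mem hne
    set M := S.max' hne with hMdef
    obtain ⟨u, hu, hMu⟩ := key U S hU h.symm M hM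
    obtain ⟨a, ha, hua⟩ := key S U hS h u hu
    have haM := S.le_max' a ha
    have huM : u = M := by omega
    rw [huM] at hu
    have hc := Finset.card_erase_add_one hM
    have h1 := value_erase hM
    have h2 := value_erase hu
    have := ih _ _ (hS.erase M) (hU.erase M) (by linarith) (by omega)
    rw [← Finset.insert_erase hM, ← Finset.insert_erase hu, this]

/-- Every natural number has exactly one base phi expansion. -/
theorem existsUnique_isExpansion (N : ℕ) : ∃! S, IsExpansion N S := by
  obtain ⟨S, hS⟩ := exists_isExpansion N
  exact ⟨S, hS, fun U hU => value_injective U S hU.1 hS.1 (hU.2.trans hS.2.symm)⟩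

/-- The base phi expansion of `N`, as the set of the positions of its digits `1`. -/
noncomputable def expansion (N : ℕ) : Finset ℤ := (existsUnique_isExpansion N).choose

theorem isExpansion_expansion (N : ℕ) : IsExpansion N (expansion N) :=
  (existsUnique_isExpansion N).choose_spec.1

theorem IsExpansion.eq_expansion {N : ℕ} {S : Finset ℤ} (h : IsExpansion N S) :
    S = expansion N :=
  (existsUnique_isExpansion N).choose_spec.2 S h

/-- The sum of digits of the base phi expansion of `N`: the digits are `0` and `1`, so this is the
number of digits `1`. -/
noncomputable def sumDigits (N : ℕ) : ℕ := (expansion N).card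

/-- The infinite word `T` over the letters `0` and `1`: the sum of digits modulo 2. -/
noncomputable def T (N : ℕ) : ℕ := sumDigits N % 2

/-- The letter `a` has frequency `f` in the infinite word `w`: the proportion of the occurrences
of `a` among the first `n` letters `w 0, …, w (n - 1)` converges to `f` as `n → ∞`. -/
def HasFrequency {A : Type*} [DecidableEq A] (w : ℕ → A) (a : A) (f : ℝ) : Prop :=
  Tendsto (fun n : ℕ => (((Finset.range n).filter (fun k => w k = a)).card : ℝ) / (n : ℝ))
    atTop (𝓝 f)

end BasePhi

/-! Equidistribution amounts to the partial sums of the signs (-1)^s(N) being o(n). Cut the naturals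
at the Lucas numbers L_m into closed even blocks [L_{2n}, L_{2n+1}] and open odd blocks between
them. Since L_{2n} = φ^{2n} + φ^{-2n} and L_{2n+1} = φ^{2n+1} - φ^{-2n-1}, the suitable Lucas shifts
change an expansion only near its two ends.

The even block from L_{2n+2} is a copy of [0, L_{2n+1}] with the same signs. The odd block from
L_{2n+5} consists of a copy of the previous odd block with signs reversed, a copy of [0, L_{2n+1}]
with the same signs, and a second reversed copy of the previous odd block.

Let E_n be the sum of signs over [0, L_{2n+1}] and O_n the sum over the next odd block. Then E_{n+1}
= 2E_n + O_n and O_{n+2} = E_n - 2O_{n+1}, hence E_{n+3} = 4E_{n+1} + E_n (`evenSum_add_three`). The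
dominant root of x³ = 4x + 1 is about 2.115, whereas L_{2n+1} grows like φ^{2n} with φ² ≈ 2.618; the
proof separates the two by 9/4 < 5/2. The same self-similarity carries the bound from whole blocks
to arbitrary partial sums (`exists_abs_signSum_le`). -/

namespace BasePhi

/-! ### Lucas numbers -/

/-- The Lucas numbers `2, 1, 3, 4, 7, 11, …`. -/
def lucas : ℕ → ℕ
  | 0 => 2
  | 1 => 1
  | n + 2 => lucas n + lucas (n + 1)

theorem lucas_add_two (n : ℕ) : lucas (n + 2) = lucas n + lucas (n + 1) := rfl

/-- Binet's formula: the conjugate of φ is -1/φ, so the sign of the second term depends on the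
parity. The recurrence mixes parities, hence the joint induction. -/
theorem lucas_cast_even_odd (n : ℕ) :
    (lucas (2 * n) : ℝ) = Real.goldenRatio ^ (2 * n : ℤ) + Real.goldenRatio ^ (-2 * n : ℤ) ∧
    (lucas (2 * n + 1) : ℝ) =
      Real.goldenRatio ^ (2 * n + 1 : ℤ) - Real.goldenRatio ^ (-2 * n - 1 : ℤ) := by
  induction n with
  | zero =>
    have h := zpow_add_zpow (-1)
    norm_num [lucas] at h ⊢
    linarith
  | succ n ih =>
    obtain ⟨h0, h1⟩ := ih
    have e0 := zpow_add_zpow (2 * n : ℤ)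
    have e1 := zpow_add_zpow (2 * n + 1 : ℤ)
    have e2 := zpow_add_zpow (-2 * n - 2 : ℤ)
    have e3 := zpow_add_zpow (-2 * n - 3 : ℤ)
    have hA : (lucas (2 * (n + 1)) : ℝ) = lucas (2 * n) + lucas (2 * n + 1) := by
      exact_mod_cast lucas_add_two (2 * n)
    have hB : (lucas (2 * (n + 1) + 1) : ℝ) = lucas (2 * n + 1) + lucas (2 * (n + 1)) := by
      exact_mod_cast lucas_add_two (2 * n + 1)
    rw [hB, hA, h0, h1]
    push_cast
    ring_nf at e0 e1 e2 e3 ⊢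
    constructor <;> linarith

theorem lucas_pos (n : ℕ) : 0 < lucas n := by
  induction n using Nat.twoStepInduction with
  | zero => decide
  | one => decide
  | more n h1 h2 => rw [lucas_add_two]; omega

/-! ### Recursive structure of the expansions -/

theorem IsExpansion.sumDigits_eq {N : ℕ} {S : Finset ℤ} (h : IsExpansion N S) :
    sumDigits N = S.card := by
  rw [sumDigits, ← h.eq_expansion]

theorem expansion_zero : expansion 0 = ∅ :=
  (IsExpansion.eq_expansion ⟨fun i hi => absurd hi (Finset.notMem_empty i), by simp [value]⟩).symm

theorem expansion_one : expansion 1 = {0} :=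
  (IsExpansion.eq_expansion ⟨by simp [Admissible], by simp [value]⟩).symm

theorem expansion_two : expansion 2 = {1, -2} := by
  refine (IsExpansion.eq_expansion ⟨by simp [Admissible], ?_⟩).symm
  have h := (lucas_cast_even_odd 1).1
  have h' := zpow_add_zpow 0
  rw [value, Finset.sum_pair (by decide)]
  norm_num [lucas] at h h' ⊢
  linarith

/-- Expansions with positions in `[-2n, 2n]` can be shifted by `lucas (2n + 2)`. -/
theorem IsExpansion.lucas_even_add {n j : ℕ} {S : Finset ℤ} (h : IsExpansion j S)
    (hS : ∀ i ∈ S, -2 * (n : ℤ) ≤ i ∧ i ≤ 2 * n) :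
    IsExpansion (lucas (2 * n + 2) + j) (insert (2 * n + 2 : ℤ) (insert (-2 * n - 2 : ℤ) S)) := by
  have hlow : ∀ i : ℤ, i < -2 * n → i ∉ S := fun i hi h => by have := hS i h; omega
  have hhigh : ∀ i : ℤ, 2 * n < i → i ∉ S := fun i hi h => by have := hS i h; omega
  have h1 : (-2 * n - 2 : ℤ) ∉ S := hlow _ (by omega)
  have h2 : (2 * n + 2 : ℤ) ∉ insert (-2 * n - 2 : ℤ) S := by
    rw [Finset.mem_insert, not_or]
    exact ⟨by omega, hhigh _ (by omega)⟩
  refine ⟨(h.1.insert (hlow _ (by omega)) (hlow _ (by omega))).insert ?_ ?_, ?_⟩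
  · rw [Finset.mem_insert, not_or]
    exact ⟨by omega, hhigh _ (by omega)⟩
  · rw [Finset.mem_insert, not_or]
    exact ⟨by omega, hhigh _ (by omega)⟩
  · have hL := (lucas_cast_even_odd (n + 1)).1
    rw [value_insert h2, value_insert h1, h.2, Nat.cast_add,
      show 2 * n + 2 = 2 * (n + 1) by ring, hL]
    push_cast
    ring_nf

/-- The shape of the expansions of the numbers strictly between `lucas (2n + 1)` and
`lucas (2n + 2)`. -/
structure OddShape (n : ℕ) (S : Finset ℤ) : Prop where
  bounds : ∀ i ∈ S, -2 * (n : ℤ) - 2 ≤ i ∧ i ≤ 2 * n + 1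
  top : (2 * n + 1 : ℤ) ∈ S
  bottom : (-2 * n - 2 : ℤ) ∈ S
  gap : (-2 * n : ℤ) ∉ S

/-- Adding φ^{2n+2} + φ^{-2n-2} causes one carry at each end: φ^{2n+1} + φ^{2n+2} = φ^{2n+3} at the
top, 2φ^{-2n-2} = φ^{-2n-1} + φ^{-2n-4} at the bottom. The field `gap` keeps the new digit at -2n-1
admissible. Two digits go and three come, which reverses the sign. -/
theorem IsExpansion.odd_first {n N : ℕ} {S : Finset ℤ} (h : IsExpansion N S) (hS : OddShape n S) :
    ∃ U, IsExpansion (lucas (2 * n + 2) + N) U ∧ OddShape (n + 1) U ∧ U.card = S.card + 1 := by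
  have hA := h.1
  have hg : (-2 * n - 1 : ℤ) ∉ S := fun h' => hA _ hS.bottom (by convert h' using 1; ring)
  have ht : (2 * n : ℤ) ∉ S := fun h' => hA _ h' hS.top
  obtain ⟨V, hV⟩ : ∃ V, V = (S.erase (2 * n + 1 : ℤ)).erase (-2 * n - 2 : ℤ) := ⟨_, rfl⟩
  have hVm : ∀ i, i ∈ V ↔ i ≠ -2 * n - 2 ∧ i ≠ 2 * n + 1 ∧ i ∈ S := by
    intro i; rw [hV, Finset.mem_erase, Finset.mem_erase]
  have hb : ∀ i ∈ V, -2 * (n : ℤ) < i ∧ i < 2 * n := by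
    intro i hi
    obtain ⟨h1, h2, h3⟩ := (hVm i).1 hi
    have h4 := hS.bounds i h3
    have h5 : i ≠ 2 * n := fun h' => ht (h' ▸ h3)
    have h6 : i ≠ -2 * n - 1 := fun h' => hg (h' ▸ h3)
    have h7 : i ≠ -2 * n := fun h' => hS.gap (h' ▸ h3)
    omega
  have hVA : Admissible V := hV ▸ (hA.erase _).erase _
  have hbot : (-2 * n - 2 : ℤ) ∈ S.erase (2 * n + 1 : ℤ) :=
    Finset.mem_erase.2 ⟨by omega, hS.bottom⟩
  have c1 := Finset.card_erase_add_one hS.top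
  have c2 := Finset.card_erase_add_one hbot
  have v1 := value_erase hS.top
  have v2 := value_erase hbot
  rw [← hV] at c2 v2
  have n1 : (-2 * n - 1 : ℤ) ∉ V := fun h' => by have := hb _ h'; omega
  have n2 : (-2 * n - 4 : ℤ) ∉ insert (-2 * n - 1 : ℤ) V := by
    rw [Finset.mem_insert, not_or]
    exact ⟨by omega, fun h' => by have := hb _ h'; omega⟩
  have n3 : (2 * n + 3 : ℤ) ∉ insert (-2 * n - 4 : ℤ) (insert (-2 * n - 1 : ℤ) V) := by
    rw [Finset.mem_insert, Finset.mem_insert, not_or, not_or]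
    exact ⟨by omega, by omega, fun h' => by have := hb _ h'; omega⟩
  refine ⟨insert (2 * n + 3 : ℤ) (insert (-2 * n - 4 : ℤ) (insert (-2 * n - 1 : ℤ) V)),
    ⟨?_, ?_⟩, ⟨?_, ?_, ?_, ?_⟩, ?_⟩
  · refine ((hVA.insert ?_ ?_).insert ?_ ?_).insert ?_ ?_ <;>
      (try simp only [Finset.mem_insert, not_or]) <;>
      (try refine ⟨by omega, ?_⟩) <;> (try refine ⟨by omega, ?_⟩) <;>
      exact fun h' => by have := hb _ h'; omega
  · have hL := (lucas_cast_even_odd (n + 1)).1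
    have e1 := two_mul_zpow (-2 * n - 2 : ℤ)
    have e2 := zpow_add_zpow (2 * n + 1 : ℤ)
    rw [value_insert n3, value_insert n2, value_insert n1, Nat.cast_add,
      show 2 * n + 2 = 2 * (n + 1) by ring, hL, ← h.2]
    push_cast
    ring_nf at e1 e2 v1 v2 ⊢
    linarith
  · intro i hi
    simp only [Finset.mem_insert] at hi
    push_cast
    rcases hi with rfl | rfl | rfl | hi
    · omega
    · omega
    · omega
    · have := hb _ hi; omega
  · rw [Finset.mem_insert]; left; push_cast; ring
  · rw [Finset.mem_insert, Finset.mem_insert]; right; left; push_cast; ring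
  · simp only [Finset.mem_insert, not_or]
    push_cast
    exact ⟨by omega, by omega, by omega, fun h' => by have := hb _ h'; omega⟩
  · rw [Finset.card_insert_of_notMem n3, Finset.card_insert_of_notMem n2,
      Finset.card_insert_of_notMem n1]
    omega

/-- The negative term of L_{2n+3} is absorbed by the bottom digit: φ^{-2n-2} - φ^{-2n-3} =
φ^{-2n-4}. The top digit φ^{2n+3} is simply added, so the sign is reversed. -/
theorem IsExpansion.odd_last {n N : ℕ} {S : Finset ℤ} (h : IsExpansion N S) (hS : OddShape n S) :
    ∃ U, IsExpansion (lucas (2 * n + 3) + N) U ∧ OddShape (n + 1) U ∧ U.card = S.card + 1 := by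
  have hA := h.1
  have hg : (-2 * n - 1 : ℤ) ∉ S := fun h' => hA _ hS.bottom (by convert h' using 1; ring)
  obtain ⟨V, hV⟩ : ∃ V, V = S.erase (-2 * n - 2 : ℤ) := ⟨_, rfl⟩
  have hVm : ∀ i, i ∈ V ↔ i ≠ -2 * n - 2 ∧ i ∈ S := by
    intro i; rw [hV, Finset.mem_erase]
  have hb : ∀ i ∈ V, -2 * (n : ℤ) < i ∧ i ≤ 2 * n + 1 := by
    intro i hi
    obtain ⟨h1, h3⟩ := (hVm i).1 hi
    have h4 := hS.bounds i h3
    have h6 : i ≠ -2 * n - 1 := fun h' => hg (h' ▸ h3)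
    have h7 : i ≠ -2 * n := fun h' => hS.gap (h' ▸ h3)
    omega
  have hVA : Admissible V := hV ▸ hA.erase _
  have c1 := Finset.card_erase_add_one hS.bottom
  have v1 := value_erase hS.bottom
  rw [← hV] at c1 v1
  have n1 : (-2 * n - 4 : ℤ) ∉ V := fun h' => by have := hb _ h'; omega
  have n2 : (2 * n + 3 : ℤ) ∉ insert (-2 * n - 4 : ℤ) V := by
    rw [Finset.mem_insert, not_or]
    exact ⟨by omega, fun h' => by have := hb _ h'; omega⟩
  refine ⟨insert (2 * n + 3 : ℤ) (insert (-2 * n - 4 : ℤ) V), ⟨?_, ?_⟩, ⟨?_, ?_, ?_, ?_⟩, ?_⟩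
  · refine (hVA.insert ?_ ?_).insert ?_ ?_ <;>
      (try simp only [Finset.mem_insert, not_or]) <;>
      (try refine ⟨by omega, ?_⟩) <;>
      exact fun h' => by have := hb _ h'; omega
  · have hL := (lucas_cast_even_odd (n + 1)).2
    have e1 := zpow_add_zpow (-2 * n - 4 : ℤ)
    rw [value_insert n2, value_insert n1, Nat.cast_add,
      show 2 * n + 3 = 2 * (n + 1) + 1 by ring, hL, ← h.2]
    push_cast
    ring_nf at e1 v1 ⊢
    linarith
  · intro i hi
    simp only [Finset.mem_insert] at hi
    push_cast
    rcases hi with rfl | rfl | hi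
    · omega
    · omega
    · have := hb _ hi; omega
  · rw [Finset.mem_insert]; left; push_cast; ring
  · rw [Finset.mem_insert, Finset.mem_insert]; right; left; push_cast; ring
  · simp only [Finset.mem_insert, not_or]
    push_cast
    exact ⟨by omega, by omega, fun h' => by have := hb _ h'; omega⟩
  · rw [Finset.card_insert_of_notMem n2, Finset.card_insert_of_notMem n1]
    omega

/-- The negative powers in L_{2n+5} + L_{2n+2} combine to φ^{-2n-2} - φ^{-2n-5} = φ^{-2n-3} +
φ^{-2n-6}, so four digits are placed outside the old ones and the sign is kept. -/
theorem IsExpansion.odd_middle {n j : ℕ} {S : Finset ℤ} (h : IsExpansion j S)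
    (hS : ∀ i ∈ S, -2 * (n : ℤ) ≤ i ∧ i ≤ 2 * n) :
    ∃ U, IsExpansion (lucas (2 * n + 5) + (lucas (2 * n + 2) + j)) U ∧ OddShape (n + 2) U ∧
      U.card = S.card + 4 := by
  have n1 : (-2 * n - 3 : ℤ) ∉ S := fun h' => by have := hS _ h'; omega
  have n2 : (-2 * n - 6 : ℤ) ∉ insert (-2 * n - 3 : ℤ) S := by
    rw [Finset.mem_insert, not_or]
    exact ⟨by omega, fun h' => by have := hS _ h'; omega⟩
  have n3 : (2 * n + 2 : ℤ) ∉ insert (-2 * n - 6 : ℤ) (insert (-2 * n - 3 : ℤ) S) := by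
    rw [Finset.mem_insert, Finset.mem_insert, not_or, not_or]
    exact ⟨by omega, by omega, fun h' => by have := hS _ h'; omega⟩
  have n4 : (2 * n + 5 : ℤ) ∉
      insert (2 * n + 2 : ℤ) (insert (-2 * n - 6 : ℤ) (insert (-2 * n - 3 : ℤ) S)) := by
    simp only [Finset.mem_insert, not_or]
    exact ⟨by omega, by omega, by omega, fun h' => by have := hS _ h'; omega⟩
  refine ⟨insert (2 * n + 5 : ℤ)
    (insert (2 * n + 2 : ℤ) (insert (-2 * n - 6 : ℤ) (insert (-2 * n - 3 : ℤ) S))),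
    ⟨?_, ?_⟩, ⟨?_, ?_, ?_, ?_⟩, ?_⟩
  · refine (((h.1.insert ?_ ?_).insert ?_ ?_).insert ?_ ?_).insert ?_ ?_ <;>
      (try simp only [Finset.mem_insert, not_or]) <;>
      (try refine ⟨by omega, ?_⟩) <;> (try refine ⟨by omega, ?_⟩) <;>
      (try refine ⟨by omega, ?_⟩) <;>
      exact fun h' => by have := hS _ h'; omega
  · have hL := (lucas_cast_even_odd (n + 2)).2
    have hL' := (lucas_cast_even_odd (n + 1)).1
    have e1 := zpow_add_zpow (-2 * n - 4 : ℤ)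
    have e2 := zpow_add_zpow (-2 * n - 6 : ℤ)
    rw [value_insert n4, value_insert n3, value_insert n2, value_insert n1, Nat.cast_add,
      Nat.cast_add, show 2 * n + 5 = 2 * (n + 2) + 1 by ring, hL,
      show 2 * n + 2 = 2 * (n + 1) by ring, hL', ← h.2]
    push_cast
    ring_nf at e1 e2 ⊢
    linarith
  · intro i hi
    simp only [Finset.mem_insert] at hi
    push_cast
    rcases hi with rfl | rfl | rfl | rfl | hi
    · omega
    · omega
    · omega
    · omega
    · have := hS _ hi; omega
  · simp only [Finset.mem_insert]; left; push_cast; ring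
  · simp only [Finset.mem_insert]; right; right; left; push_cast; ring
  · simp only [Finset.mem_insert, not_or]
    push_cast
    exact ⟨by omega, by omega, by omega, by omega, fun h' => by have := hS _ h'; omega⟩
  · rw [Finset.card_insert_of_notMem n4, Finset.card_insert_of_notMem n3,
      Finset.card_insert_of_notMem n2, Finset.card_insert_of_notMem n1]

/-- This supplies the digit information that the shifts require. The middle part of an odd block
reaches back two indices, hence strong induction. -/
theorem expansion_bounds_and_oddShape (n : ℕ) :
    (∀ k ≤ lucas (2 * n + 1), ∀ i ∈ expansion k, -2 * (n : ℤ) ≤ i ∧ i ≤ 2 * n) ∧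
    (∀ k, lucas (2 * n + 1) < k → k < lucas (2 * n + 2) → OddShape n (expansion k)) := by
  induction n using Nat.strong_induction_on with
  | _ n ih =>
  rcases n with _ | n
  · refine ⟨fun k hk => ?_, fun k hk hk' => ?_⟩
    · have : k = 0 ∨ k = 1 := by simp only [lucas] at hk; omega
      rcases this with rfl | rfl
      · simp [expansion_zero]
      · simp [expansion_one]
    · have : k = 2 := by simp only [lucas] at hk hk'; omega
      subst this
      rw [expansion_two]
      exact ⟨by simp, by simp, by simp, by simp⟩
  · obtain ⟨hP, hQ⟩ := ih n (by omega)
    have r2 : lucas (2 * n + 2) = lucas (2 * n) + lucas (2 * n + 1) := rfl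
    have r3 : lucas (2 * n + 3) = lucas (2 * n + 1) + lucas (2 * n + 2) := rfl
    have r4 : lucas (2 * n + 4) = lucas (2 * n + 2) + lucas (2 * n + 3) := rfl
    refine ⟨fun k hk => ?_, fun k hk hk' => ?_⟩
    · rw [show 2 * (n + 1) + 1 = 2 * n + 3 by ring] at hk
      push_cast
      rcases Nat.lt_or_ge (lucas (2 * n + 1)) k with h1 | h1
      · rcases Nat.lt_or_ge k (lucas (2 * n + 2)) with h2 | h2
        · intro i hi
          have := (hQ k h1 h2).bounds i hi
          omega
        · obtain ⟨j, rfl⟩ := Nat.exists_eq_add_of_le h2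
          have hj : j ≤ lucas (2 * n + 1) := by omega
          rw [← ((isExpansion_expansion j).lucas_even_add (hP j hj)).eq_expansion]
          intro i hi
          simp only [Finset.mem_insert] at hi
          rcases hi with rfl | rfl | hi
          · omega
          · omega
          · have := hP j hj i hi; omega
      · intro i hi
        have := hP k h1 i hi
        omega
    · rw [show 2 * (n + 1) + 1 = 2 * n + 3 by ring] at hk
      rw [show 2 * (n + 1) + 2 = 2 * n + 4 by ring] at hk'
      by_cases h1 : k < lucas (2 * n + 3) + lucas (2 * n)
      · obtain ⟨j, rfl⟩ := Nat.exists_eq_add_of_le (show lucas (2 * n + 2) ≤ k by omega)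
        obtain ⟨U, hU, hU', -⟩ :=
          (isExpansion_expansion j).odd_first (hQ j (by omega) (by omega))
        rwa [← hU.eq_expansion]
      · by_cases h2 : lucas (2 * n + 3) + lucas (2 * n + 1) < k
        · obtain ⟨j, rfl⟩ := Nat.exists_eq_add_of_le (show lucas (2 * n + 3) ≤ k by omega)
          obtain ⟨U, hU, hU', -⟩ :=
            (isExpansion_expansion j).odd_last (hQ j (by omega) (by omega))
          rwa [← hU.eq_expansion]
        -- In the odd block {5, 6} the middle part is empty.
        · rcases n with _ | n
          · simp only [lucas] at h1 h2; omega
          · clear hP hQ r2 r3 r4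
            have r5 : lucas (2 * n + 3) = lucas (2 * n + 1) + lucas (2 * n + 2) := rfl
            rw [show 2 * (n + 1) + 3 = 2 * n + 5 by ring,
              show 2 * (n + 1) + 1 = 2 * n + 3 by ring] at h2
            rw [show 2 * (n + 1) + 3 = 2 * n + 5 by ring,
              show 2 * (n + 1) = 2 * n + 2 by ring] at h1
            obtain ⟨j, rfl⟩ := Nat.exists_eq_add_of_le
              (show lucas (2 * n + 5) + lucas (2 * n + 2) ≤ k by omega)
            obtain ⟨U, hU, hU', -⟩ := (isExpansion_expansion j).odd_middle
              ((ih n (by omega)).1 j (by omega))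
            rw [← add_assoc] at hU
            rw [← hU.eq_expansion]
            exact hU'

/-! ### Signs -/

/-- The sign `(-1) ^ s(N)`, where `s(N)` is the sum of digits. -/
noncomputable def sign (N : ℕ) : ℝ := (-1) ^ sumDigits N

theorem sign_lucas_even_add {n j : ℕ} (hj : j ≤ lucas (2 * n + 1)) :
    sign (lucas (2 * n + 2) + j) = sign j := by
  have hb := (expansion_bounds_and_oddShape n).1 j hj
  have h1 : (-2 * n - 2 : ℤ) ∉ expansion j := fun h => by have := hb _ h; omega
  have h2 : (2 * n + 2 : ℤ) ∉ insert (-2 * n - 2 : ℤ) (expansion j) := by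
    rw [Finset.mem_insert, not_or]
    exact ⟨by omega, fun h => by have := hb _ h; omega⟩
  rw [sign, sign, ((isExpansion_expansion j).lucas_even_add hb).sumDigits_eq,
    Finset.card_insert_of_notMem h2, Finset.card_insert_of_notMem h1, sumDigits]
  ring

theorem sign_odd_first {n k : ℕ} (h1 : lucas (2 * n + 1) < k) (h2 : k < lucas (2 * n + 2)) :
    sign (lucas (2 * n + 2) + k) = -sign k := by
  obtain ⟨U, hU, -, hc⟩ := (isExpansion_expansion k).odd_first
    ((expansion_bounds_and_oddShape n).2 k h1 h2)
  rw [sign, sign, hU.sumDigits_eq, hc, sumDigits]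
  ring

theorem sign_odd_last {n k : ℕ} (h1 : lucas (2 * n + 1) < k) (h2 : k < lucas (2 * n + 2)) :
    sign (lucas (2 * n + 3) + k) = -sign k := by
  obtain ⟨U, hU, -, hc⟩ := (isExpansion_expansion k).odd_last
    ((expansion_bounds_and_oddShape n).2 k h1 h2)
  rw [sign, sign, hU.sumDigits_eq, hc, sumDigits]
  ring

theorem sign_odd_middle {n j : ℕ} (hj : j ≤ lucas (2 * n + 1)) :
    sign (lucas (2 * n + 5) + (lucas (2 * n + 2) + j)) = sign j := by
  obtain ⟨U, hU, -, hc⟩ := (isExpansion_expansion j).odd_middle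
    ((expansion_bounds_and_oddShape n).1 j hj)
  rw [sign, sign, hU.sumDigits_eq, hc, sumDigits]
  ring

/-! ### Partial sums of the signs -/

/-- The sum of the signs of the numbers below `m`. -/
noncomputable def signSum (m : ℕ) : ℝ := ∑ N ∈ Finset.range m, sign N

theorem signSum_lucas_even_add {n m : ℕ} (hm : m ≤ lucas (2 * n + 1) + 1) :
    signSum (lucas (2 * n + 2) + m) = signSum (lucas (2 * n + 2)) + signSum m := by
  rw [signSum, Finset.sum_range_add]
  congr 1
  exact Finset.sum_congr rfl fun j hj =>
    sign_lucas_even_add (by have := Finset.mem_range.1 hj; omega)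

/-- The open odd block starts at L_{2n+1} + 1 and has L_{2n} - 1 elements, which explains both
offsets. Shifting it by L_{2n+2} lands at L_{2n+3} + 1. -/
theorem signSum_odd_first {n m : ℕ} (hm : m + 1 ≤ lucas (2 * n)) :
    signSum (lucas (2 * n + 3) + 1 + m) - signSum (lucas (2 * n + 3) + 1) =
      -(signSum (lucas (2 * n + 1) + 1 + m) - signSum (lucas (2 * n + 1) + 1)) := by
  have r2 : lucas (2 * n + 2) = lucas (2 * n) + lucas (2 * n + 1) := rfl
  have r3 : lucas (2 * n + 3) = lucas (2 * n + 1) + lucas (2 * n + 2) := rfl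
  simp only [signSum, Finset.sum_range_add, add_sub_cancel_left]
  rw [← Finset.sum_neg_distrib]
  refine Finset.sum_congr rfl fun j hj => ?_
  have := Finset.mem_range.1 hj
  rw [← sign_odd_first (n := n) (by omega) (by omega)]
  congr 1
  omega

theorem signSum_odd_middle {n m : ℕ} (hm : m ≤ lucas (2 * n + 1) + 1) :
    signSum (lucas (2 * n + 5) + lucas (2 * n + 2) + m) =
      signSum (lucas (2 * n + 5) + lucas (2 * n + 2)) + signSum m := by
  rw [signSum, Finset.sum_range_add]
  congr 1
  refine Finset.sum_congr rfl fun j hj => ?_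
  rw [add_assoc]
  exact sign_odd_middle (by have := Finset.mem_range.1 hj; omega)

theorem signSum_odd_last {n m : ℕ} (hm : m + 1 ≤ lucas (2 * n)) :
    signSum (lucas (2 * n + 3) + lucas (2 * n + 1) + 1 + m) -
        signSum (lucas (2 * n + 3) + lucas (2 * n + 1) + 1) =
      -(signSum (lucas (2 * n + 1) + 1 + m) - signSum (lucas (2 * n + 1) + 1)) := by
  have r2 : lucas (2 * n + 2) = lucas (2 * n) + lucas (2 * n + 1) := rfl
  simp only [signSum, Finset.sum_range_add _ (_ + 1), add_sub_cancel_left]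
  rw [← Finset.sum_neg_distrib]
  refine Finset.sum_congr rfl fun j hj => ?_
  have := Finset.mem_range.1 hj
  rw [← sign_odd_last (n := n) (by omega) (by omega)]
  congr 1
  ring

/-! ### Recurrences for the block sums -/

/-- The sum of the signs over `[0, lucas (2n + 1)]`. -/
noncomputable def evenSum (n : ℕ) : ℝ := signSum (lucas (2 * n + 1) + 1)

/-- The sum of the signs strictly between `lucas (2n + 1)` and `lucas (2n + 2)`. -/
noncomputable def oddSum (n : ℕ) : ℝ := signSum (lucas (2 * n + 2)) - evenSum n

theorem evenSum_succ (n : ℕ) : evenSum (n + 1) = 2 * evenSum n + oddSum n := by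
  have h := signSum_lucas_even_add (le_refl (lucas (2 * n + 1) + 1))
  have r3 : lucas (2 * n + 3) = lucas (2 * n + 1) + lucas (2 * n + 2) := rfl
  rw [show lucas (2 * n + 2) + (lucas (2 * n + 1) + 1) = lucas (2 * n + 3) + 1 by omega] at h
  rw [evenSum, show 2 * (n + 1) + 1 = 2 * n + 3 by ring, h, oddSum, evenSum]
  ring

theorem signSum_odd_first_end (n : ℕ) :
    signSum (lucas (2 * n + 3) + lucas (2 * n)) = evenSum (n + 1) - oddSum n := by
  obtain ⟨m, hm⟩ := Nat.exists_eq_add_of_le (Nat.succ_le_of_lt (lucas_pos (2 * n)))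
  have h := signSum_odd_first (n := n) (m := m) (by omega)
  have r2 : lucas (2 * n + 2) = lucas (2 * n) + lucas (2 * n + 1) := rfl
  rw [show lucas (2 * n + 3) + 1 + m = lucas (2 * n + 3) + lucas (2 * n) by omega,
    show lucas (2 * n + 1) + 1 + m = lucas (2 * n + 2) by omega] at h
  rw [oddSum, evenSum, evenSum, show 2 * (n + 1) + 1 = 2 * n + 3 by ring]
  linarith

theorem signSum_odd_middle_end (n : ℕ) :
    signSum (lucas (2 * n + 5) + lucas (2 * n + 3) + 1) =
      evenSum (n + 2) - oddSum (n + 1) + evenSum n := by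
  have h := signSum_odd_middle (le_refl (lucas (2 * n + 1) + 1))
  have h' := signSum_odd_first_end (n + 1)
  have r3 : lucas (2 * n + 3) = lucas (2 * n + 1) + lucas (2 * n + 2) := rfl
  rw [show lucas (2 * n + 5) + lucas (2 * n + 2) + (lucas (2 * n + 1) + 1) =
    lucas (2 * n + 5) + lucas (2 * n + 3) + 1 by omega] at h
  rw [show 2 * (n + 1) + 3 = 2 * n + 5 by ring, show 2 * (n + 1) = 2 * n + 2 by ring] at h'
  rw [h, h', evenSum.eq_1 n]

theorem oddSum_add_two (n : ℕ) : oddSum (n + 2) = evenSum n - 2 * oddSum (n + 1) := by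
  obtain ⟨m, hm⟩ := Nat.exists_eq_add_of_le (Nat.succ_le_of_lt (lucas_pos (2 * (n + 1))))
  have h := signSum_odd_last (n := n + 1) (m := m) (by omega)
  have hmid := signSum_odd_middle_end n
  have r4 : lucas (2 * n + 4) = lucas (2 * n + 2) + lucas (2 * n + 3) := rfl
  have r6 : lucas (2 * n + 6) = lucas (2 * n + 4) + lucas (2 * n + 5) := rfl
  have e : oddSum (n + 2) = signSum (lucas (2 * n + 6)) - evenSum (n + 2) := rfl
  have e' : oddSum (n + 1) = signSum (lucas (2 * n + 4)) - signSum (lucas (2 * n + 3) + 1) := rfl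
  rw [show 2 * (n + 1) + 3 = 2 * n + 5 by ring, show 2 * (n + 1) + 1 = 2 * n + 3 by ring] at h
  rw [show 2 * (n + 1) = 2 * n + 2 by ring] at hm
  rw [show lucas (2 * n + 5) + lucas (2 * n + 3) + 1 + m = lucas (2 * n + 6) by omega,
    show lucas (2 * n + 3) + 1 + m = lucas (2 * n + 4) by omega] at h
  linarith

theorem evenSum_add_three (n : ℕ) : evenSum (n + 3) = 4 * evenSum (n + 1) + evenSum n := by
  have h1 := evenSum_succ (n + 1)
  have h2 := evenSum_succ (n + 2)
  have h3 := oddSum_add_two n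
  simp only [add_assoc, Nat.reduceAdd] at h1 h2
  linarith

/-! ### Growth of block sums and partial sums -/

theorem exists_abs_evenSum_le : ∃ C : ℝ, 0 ≤ C ∧ ∀ n, |evenSum n| ≤ C * (9 / 4) ^ n := by
  refine ⟨|evenSum 0| + |evenSum 1| + |evenSum 2|, by positivity, fun n => ?_⟩
  set C := |evenSum 0| + |evenSum 1| + |evenSum 2| with hC
  have h0 := abs_nonneg (evenSum 0)
  have h1 := abs_nonneg (evenSum 1)
  have h2 := abs_nonneg (evenSum 2)
  induction n using Nat.strong_induction_on with
  | _ n ih =>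
  match n with
  | 0 => norm_num; linarith
  | 1 => norm_num; linarith
  | 2 => norm_num; linarith
  | n + 3 =>
    have i0 := ih n (by omega)
    have i1 := ih (n + 1) (by omega)
    -- The induction closes because 4 · (9/4) + 1 = 10 ≤ (9/4)³.
    have hp : 0 ≤ C * (9 / 4) ^ n := by positivity
    rw [evenSum_add_three]
    have := abs_add_le (4 * evenSum (n + 1)) (evenSum n)
    rw [abs_mul, abs_of_pos (show (0 : ℝ) < 4 by norm_num)] at this
    rw [pow_succ] at i1 ⊢
    rw [pow_succ, pow_succ]
    linarith

theorem exists_abs_evenSum_oddSum_le :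
    ∃ C : ℝ, 0 ≤ C ∧ ∀ n, |evenSum n| ≤ C * (9 / 4) ^ n ∧ |oddSum n| ≤ C * (9 / 4) ^ n := by
  obtain ⟨C, hC, h⟩ := exists_abs_evenSum_le
  -- O_n = E_{n+1} - 2E_n costs a factor 9/4 + 2 ≤ 5.
  refine ⟨5 * C, by positivity, fun n => ?_⟩
  have h0 := h n
  have h1 := h (n + 1)
  have hs := evenSum_succ n
  have hp : 0 ≤ C * (9 / 4) ^ n := by positivity
  rw [pow_succ] at h1
  rw [abs_le] at *
  constructor
  · constructor <;> linarith
  · rw [abs_le]; constructor <;> linarith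

theorem abs_signSum_add_sub_le (a m : ℕ) : |signSum (a + m) - signSum a| ≤ m := by
  rw [signSum, signSum, Finset.sum_range_add, add_sub_cancel_left]
  refine (Finset.abs_sum_le_sum_abs _ _).trans ?_
  simp [sign, abs_pow]

/-- A partial sum consists of complete blocks, bounded through E and O, plus a partial copy of an
earlier segment or odd block, bounded by induction. Both kinds of remainder occur, hence the two
simultaneous claims. -/
theorem exists_abs_signSum_le : ∃ C : ℝ, 0 ≤ C ∧ ∀ n,
    (∀ m ≤ lucas (2 * n + 1) + 1, |signSum m| ≤ C * (9 / 4) ^ n) ∧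
    (∀ m, m + 1 ≤ lucas (2 * n) →
      |signSum (lucas (2 * n + 1) + 1 + m) - evenSum n| ≤ C * (9 / 4) ^ n) := by
  obtain ⟨C, hC, h⟩ := exists_abs_evenSum_oddSum_le
  -- The summand 2 covers the initial ranges; 2C suffices for the block sums because 2C ≤ (9/4 -
  -- 1)(2C + 2).
  refine ⟨2 * C + 2, by positivity, fun n => ?_⟩
  induction n using Nat.strong_induction_on with
  | _ n ih =>
  rcases n with _ | n
  · refine ⟨fun m hm => ?_, fun m hm => ?_⟩
    · have h1 := abs_signSum_add_sub_le 0 m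
      have h2 : (m : ℝ) ≤ 2 := by exact_mod_cast hm
      rw [zero_add, show signSum 0 = 0 by simp [signSum], sub_zero] at h1
      rw [pow_zero]
      linarith
    · have h1 := abs_signSum_add_sub_le (lucas (2 * 0 + 1) + 1) m
      have h2 : (m : ℝ) + 1 ≤ 2 := by exact_mod_cast hm
      rw [pow_zero, evenSum]
      linarith
  · obtain ⟨hP, hQ⟩ := ih n (by omega)
    obtain ⟨hE, hO⟩ := h n
    have r2 : lucas (2 * n + 2) = lucas (2 * n) + lucas (2 * n + 1) := rfl
    have r3 : lucas (2 * n + 3) = lucas (2 * n + 1) + lucas (2 * n + 2) := rfl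
    have hp : 1 ≤ (9 / 4 : ℝ) ^ n := one_le_pow₀ (by norm_num)
    have hp' : 0 ≤ C * (9 / 4 : ℝ) ^ n := by positivity
    refine ⟨fun m hm => ?_, fun m hm => ?_⟩
    · rw [show 2 * (n + 1) + 1 = 2 * n + 3 by ring] at hm
      rw [pow_succ]
      rcases Nat.lt_or_ge (lucas (2 * n + 1) + 1) m with h1 | h1
      · rcases Nat.lt_or_ge (lucas (2 * n + 2)) m with h2 | h2
        · obtain ⟨k, rfl⟩ := Nat.exists_eq_add_of_le h2.le
          have hk : k ≤ lucas (2 * n + 1) + 1 := by omega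
          rw [signSum_lucas_even_add hk]
          have i1 := hP k hk
          rw [show signSum (lucas (2 * n + 2)) = evenSum n + oddSum n by rw [oddSum]; ring]
          rw [abs_le] at *
          constructor <;> linarith
        · obtain ⟨k, rfl⟩ := Nat.exists_eq_add_of_le h1.le
          have i1 := hQ k (by omega)
          rw [abs_le] at *
          constructor <;> linarith
      · have := hP m h1
        linarith
    · rw [show 2 * (n + 1) = 2 * n + 2 by ring] at hm
      have eE : evenSum (n + 1) = signSum (lucas (2 * n + 3) + 1) := rfl
      rw [show 2 * (n + 1) + 1 = 2 * n + 3 by ring, pow_succ]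
      by_cases h1 : m + 1 ≤ lucas (2 * n)
      · have i1 := hQ m h1
        rw [eE, signSum_odd_first h1, abs_neg, ← evenSum]
        linarith
      · rcases n with _ | n
        · have i1 := abs_signSum_add_sub_le (lucas (2 * 0 + 3) + 1) m
          have i2 : (m : ℝ) + 1 ≤ 3 := by exact_mod_cast hm
          rw [eE]
          linarith
        · rcases Nat.lt_or_ge (lucas (2 * (n + 1) + 1)) m with h2 | h2
          · obtain ⟨k, rfl⟩ := Nat.exists_eq_add_of_le h2.le
            have hk : k + 1 ≤ lucas (2 * (n + 1)) := by omega
            have i1 := hQ k hk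
            have e := signSum_odd_last hk
            have e' : signSum (lucas (2 * (n + 1) + 3) + lucas (2 * (n + 1) + 1) + 1) =
              evenSum (n + 2) - oddSum (n + 1) + evenSum n := signSum_odd_middle_end n
            rw [show lucas (2 * (n + 1) + 3) + 1 + (lucas (2 * (n + 1) + 1) + k) =
              lucas (2 * (n + 1) + 3) + lucas (2 * (n + 1) + 1) + 1 + k by ring]
            rw [← evenSum] at e
            have i0 := (h n).1
            have hq : 0 ≤ C * (9 / 4 : ℝ) ^ n := by positivity
            rw [pow_succ] at *
            rw [abs_le] at *
            constructor <;> linarith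
          · obtain ⟨k, rfl⟩ :=
              Nat.exists_eq_add_of_le (show lucas (2 * (n + 1)) ≤ m by omega)
            have r4 : lucas (2 * (n + 1) + 1) = lucas (2 * n + 1) + lucas (2 * (n + 1)) := rfl
            -- The block starts one past a Lucas number, so the partial sum takes k + 1 terms of the
            -- middle part.
            have hk : k + 1 ≤ lucas (2 * n + 1) + 1 := by omega
            have i1 := hP (k + 1) (by omega)
            have e : signSum (lucas (2 * (n + 1) + 3) + lucas (2 * (n + 1)) + (k + 1)) =
              signSum (lucas (2 * (n + 1) + 3) + lucas (2 * (n + 1))) + signSum (k + 1) :=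
              signSum_odd_middle hk
            rw [signSum_odd_first_end] at e
            rw [show lucas (2 * (n + 1) + 3) + 1 + (lucas (2 * (n + 1)) + k) =
              lucas (2 * (n + 1) + 3) + lucas (2 * (n + 1)) + (k + 1) by ring, e]
            rw [abs_le] at *
            constructor <;> linarith

/-! ### Passage to the limit -/

theorem pow_le_lucas_odd (n : ℕ) : (5 / 2 : ℝ) ^ n ≤ lucas (2 * n + 1) := by
  induction n with
  | zero => norm_num [lucas]
  | succ n ih =>
    have h : 5 * lucas (2 * n + 1) ≤ 2 * lucas (2 * n + 3) := by
      have r3 : lucas (2 * n + 3) = lucas (2 * n + 1) + lucas (2 * n + 2) := rfl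
      have r2 : lucas (2 * n + 2) = lucas (2 * n) + lucas (2 * n + 1) := rfl
      rcases n with _ | n
      · simp [lucas]
      · have r1 : lucas (2 * (n + 1) + 1) = lucas (2 * n + 1) + lucas (2 * (n + 1)) := rfl
        have r0 : lucas (2 * (n + 1)) = lucas (2 * n) + lucas (2 * n + 1) := rfl
        omega
    have h' : 5 * (lucas (2 * n + 1) : ℝ) ≤ 2 * lucas (2 * n + 3) := by exact_mod_cast h
    rw [pow_succ, show 2 * (n + 1) + 1 = 2 * n + 3 by ring]
    linarith

theorem tendsto_signSum_div : Tendsto (fun n : ℕ => signSum n / (n : ℝ)) atTop (𝓝 0) := by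
  obtain ⟨C, hC, h⟩ := exists_abs_signSum_le
  have hlim : Tendsto (fun n : ℕ => C * (9 / 4) * (9 / 10 : ℝ) ^ n) atTop (𝓝 0) := by
    have := (tendsto_pow_atTop_nhds_zero_of_lt_one (r := (9 / 10 : ℝ)) (by norm_num)
      (by norm_num)).const_mul (C * (9 / 4))
    rwa [mul_zero] at this
  rw [Metric.tendsto_atTop] at hlim ⊢
  intro ε hε
  obtain ⟨n₀, hn₀⟩ := hlim ε hε
  refine ⟨lucas (2 * n₀ + 1) + 2, fun m hm => ?_⟩
  -- For the least such K, the bound at K gives |`signSum m`| ≤ C(9/4)^K, while minimality gives m ≥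
  -- L_{2K-1} ≥ (5/2)^{K-1}; the quotient is at most C · (9/4) · (9/10)^{K-1}.
  have hex : ∃ k, m ≤ lucas (2 * k + 1) + 1 := by
    obtain ⟨k, hk⟩ := pow_unbounded_of_one_lt (m : ℝ) (show (1 : ℝ) < 5 / 2 by norm_num)
    have h1 : (m : ℝ) < lucas (2 * k + 1) := hk.trans_le (pow_le_lucas_odd k)
    have h2 : m < lucas (2 * k + 1) := by exact_mod_cast h1
    exact ⟨k, by omega⟩
  have hmono : ∀ a b, a ≤ b → lucas (2 * a + 1) ≤ lucas (2 * b + 1) := by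
    refine fun a b hab => monotone_nat_of_le_succ (f := fun n => lucas (2 * n + 1)) (fun n => ?_) hab
    have r3 : lucas (2 * (n + 1) + 1) = lucas (2 * n + 1) + lucas (2 * n + 2) := rfl
    simp only [r3]
    omega
  classical
  have hK := Nat.find_spec hex
  have hmin : ∀ j, j < Nat.find hex → ¬m ≤ lucas (2 * j + 1) + 1 := fun j => Nat.find_min hex
  generalize Nat.find hex = K at hK hmin
  have hKn : n₀ < K := by
    by_contra! hcon
    have := hmono _ _ hcon
    omega
  obtain ⟨n, rfl⟩ := Nat.exists_eq_add_of_lt hKn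
  have h1 := hmin (n₀ + n) (by omega)
  have h2 : (lucas (2 * (n₀ + n) + 1) : ℝ) ≤ m := by exact_mod_cast (by omega)
  have h3 := (h (n₀ + n + 1)).1 m hK
  have h4 := hn₀ (n₀ + n) (by omega)
  have h5 := pow_le_lucas_odd (n₀ + n)
  have hp : (0 : ℝ) < (5 / 2) ^ (n₀ + n) := by positivity
  have hm0 : (0 : ℝ) < m := by linarith
  rw [Real.dist_0_eq_abs] at h4 ⊢
  have h6 := (le_abs_self _).trans_lt h4
  rw [abs_div, abs_of_pos hm0, div_lt_iff₀ hm0]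
  calc |signSum m| ≤ C * (9 / 4) ^ (n₀ + n + 1) := h3
    _ = C * (9 / 4) * (9 / 10) ^ (n₀ + n) * (5 / 2) ^ (n₀ + n) := by
      rw [mul_assoc, ← mul_pow, pow_succ]; norm_num; ring
    _ < ε * (5 / 2) ^ (n₀ + n) := mul_lt_mul_of_pos_right h6 hp
    _ ≤ ε * m := mul_le_mul_of_nonneg_left (h5.trans h2) hε.le

/-! ### Frequencies -/

theorem ite_T_eq_zero (N : ℕ) : (if T N = 0 then 1 else 0 : ℝ) = (1 + sign N) / 2 := by
  rw [T, sign]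
  rcases Nat.even_or_odd (sumDigits N) with h | h
  · rw [if_pos (Nat.even_iff.1 h), h.neg_one_pow]; norm_num
  · rw [if_neg (by rw [Nat.odd_iff.1 h]; norm_num), h.neg_one_pow]; norm_num

theorem ite_T_eq_one (N : ℕ) : (if T N = 1 then 1 else 0 : ℝ) = (1 - sign N) / 2 := by
  rw [T, sign]
  rcases Nat.even_or_odd (sumDigits N) with h | h
  · rw [if_neg (by rw [Nat.even_iff.1 h]; norm_num), h.neg_one_pow]; norm_num
  · rw [if_pos (Nat.odd_iff.1 h), h.neg_one_pow]; norm_num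

theorem card_T_eq_zero (n : ℕ) :
    (((Finset.range n).filter (fun k => T k = 0)).card : ℝ) = (n + signSum n) / 2 := by
  rw [Finset.card_filter, Nat.cast_sum]
  push_cast
  simp_rw [ite_T_eq_zero]
  rw [← Finset.sum_div, Finset.sum_add_distrib, signSum]
  simp

theorem card_T_eq_one (n : ℕ) :
    (((Finset.range n).filter (fun k => T k = 1)).card : ℝ) = (n - signSum n) / 2 := by
  rw [Finset.card_filter, Nat.cast_sum]
  push_cast
  simp_rw [ite_T_eq_one]
  rw [← Finset.sum_div, Finset.sum_sub_distrib, signSum]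
  simp

theorem hasFrequency_zero : HasFrequency T 0 (1 / 2) := by
  have h := (tendsto_signSum_div.div_const 2).const_add (1 / 2)
  rw [zero_div, add_zero] at h
  refine h.congr' ?_
  filter_upwards [eventually_gt_atTop 0] with n hn
  rw [card_T_eq_zero]
  field_simp

theorem hasFrequency_one : HasFrequency T 1 (1 / 2) := by
  have h := (tendsto_signSum_div.div_const 2).const_sub (1 / 2)
  rw [zero_div, sub_zero] at h
  refine h.congr' ?_
  filter_upwards [eventually_gt_atTop 0] with n hn
  rw [card_T_eq_one]
  field_simp

end BasePhi

theorem mainTheorem2 :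
    BasePhi.HasFrequency BasePhi.T 0 (1 / 2) ∧ BasePhi.HasFrequency BasePhi.T 1 (1 / 2) :=
  ⟨BasePhi.hasFrequency_zero, BasePhi.hasFrequency_one⟩
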